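/- **Theorem 1.7.** Setting. Let $F\colon\mathbb R^d\to\mathbb R$ be twice differentiable and $f\colon\mathbb R^d\to\mathbb R$ arbitrary. The pair $(F,f)$ satisfies the *noisy evaluation assumption* with parameters $(B,\ell,\rho,\nu)$ if $|F(x)|\le B$, $\|\nabla F(x)-\nabla F(y)\|\le \ell\|x-y\|$, $\|\nabla^2F(x)-\nabla^2F(y)\|\le\rho\|x-y\|$ and $|F(x)-f(x)|\le\nu$ for all $x,y\in\mathbb R^d$. An *$\epsilon$-SOSP* of $F$ is a point $x$ with $\|\nabla F(x)\|\le\epsilon$ and $\lambda_{\min}(\nabla^2F(x))\ge-\sqrt{\rho\epsilon}$. A *classical algorithm* is a (possibly randomized) adaptive procedure that queries exact values of $f$ at points of its choice, with arbitrary computation in between, and finally outputs a point of $\mathbb R^d$. Statement. For all $\ell,\rho>0$ there are constants $\epsilon_0\in(0,1)$ and $b>0$ such that for every $p\in\mathbb N$ and every $\theta>0$ there are $c>0$ and $d_0$ with the following property. For all $d\ge d_0$, all $0<\epsilon\le\epsilon_0$, all $B\ge b\,d\,\epsilon^{3/2}$ and all $\nu\ge d^{-p}$ there is a random function pair $(F,f)$,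 drawn uniformly from a finite nonempty indexed family of pairs that all satisfy the noisy evaluation assumption with parameters $(B,\ell,\rho,\nu)$, such that any classical algorithm that, with queries to $f$ only, outputs an $\epsilon$-SOSP of $F$ with probability at least $\theta$ (over the pair and the algorithm's randomness) makes, on at least one of these pairs, at least $c\,d/\log d$ queries with positive probability. -/

import Mathlib

/-- The Hessian of `F` at `x`, as a continuous linear endomorphism of `ℝᵈ`: the derivative of the
gradient. -/
noncomputable def hessian {d : ℕ} (F : EuclideanSpace ℝ (Fin d) → ℝ)
    (x : EuclideanSpace ℝ (Fin d)) :
    EuclideanSpace ℝ (Fin d) →L[ℝ] EuclideanSpace ℝ (Fin d) :=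
  fderiv ℝ (gradient F) x

/-- The noisy evaluation assumption: the target `F` is twice differentiable, `B`-bounded,
`ℓ`-smooth and `ρ`-Hessian Lipschitz (operator norm) on all of `ℝᵈ`, and the noisy function `f`
is pointwise `ν`-close to `F`. Nothing else is assumed about `f`. -/
structure NoisyEvaluation {d : ℕ} (B ℓ ρ ν : ℝ) (F f : EuclideanSpace ℝ (Fin d) → ℝ) :
    Prop where
  differentiable : Differentiable ℝ F
  differentiable_gradient : Differentiable ℝ (gradient F)
  bounded : ∀ x, |F x| ≤ B
  smooth : ∀ x y, ‖gradient F x - gradient F y‖ ≤ ℓ * ‖x - y‖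
  hessian_lipschitz : ∀ x y, ‖hessian F x - hessian F y‖ ≤ ρ * ‖x - y‖
  close : ∀ x, |F x - f x| ≤ ν

/-- `x` is an `ε`-approximate second-order stationary point of the `ρ`-Hessian Lipschitz function
`F`: `‖∇F(x)‖ ≤ ε` and `λ_min(∇²F(x)) ≥ -√(ρε)`, i.e. every eigenvalue of the Hessian is at
least `-√(ρε)`. -/
def IsSOSP {d : ℕ} (ρ ε : ℝ) (F : EuclideanSpace ℝ (Fin d) → ℝ)
    (x : EuclideanSpace ℝ (Fin d)) : Prop :=
  ‖gradient F x‖ ≤ ε ∧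
    ∀ lam : ℝ, Module.End.HasEigenvalue (hessian F x).toLinearMap lam → -√(ρ * ε) ≤ lam

/-- A deterministic classical (adaptive) algorithm with access to a zeroth-order oracle on `ℝᵈ`.
It either stops and outputs a point, or queries the oracle at a point and continues in a way that
depends arbitrarily on the exact real answer. Only queries are counted; computation is free. -/
inductive QueryAlgorithm (d : ℕ) : Type where
  | output (x : EuclideanSpace ℝ (Fin d)) : QueryAlgorithm d
  | query (x : EuclideanSpace ℝ (Fin d)) (next : ℝ → QueryAlgorithm d) : QueryAlgorithm d

/-- The point output by the algorithm when its queries are answered by `f`. -/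
def QueryAlgorithm.run {d : ℕ} (f : EuclideanSpace ℝ (Fin d) → ℝ) :
    QueryAlgorithm d → EuclideanSpace ℝ (Fin d)
  | .output x => x
  | .query x next => QueryAlgorithm.run f (next (f x))

/-- The number of queries made by the algorithm when they are answered by `f`. -/
def QueryAlgorithm.numQueries {d : ℕ} (f : EuclideanSpace ℝ (Fin d) → ℝ) :
    QueryAlgorithm d → ℕ
  | .output _ => 0
  | .query x next => QueryAlgorithm.numQueries f (next (f x)) + 1

/-- A randomized classical algorithm is a family `A ω` of deterministic ones, with the seed `ω`
drawn from the probability measure `P`. This is its failure probability on the pair `(F, f)`: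
the probability that, run with queries to `f`, it outputs a point that is not an `ε`-SOSP of `F`.
No measurability of `A` is required (`P` is then the outer measure of the failure event, so that
the failure probability is at most `δ` iff success holds on an event of probability at least
`1 - δ`). -/
noncomputable def failureProb {d : ℕ} {Ω : Type*} [MeasurableSpace Ω]
    (P : MeasureTheory.Measure Ω) (A : Ω → QueryAlgorithm d) (ρ ε : ℝ)
    (F f : EuclideanSpace ℝ (Fin d) → ℝ) : ℝ :=
  P.real {ω | ¬ IsSOSP ρ ε F ((A ω).run f)}

/-!
The hard functions are separable sine waves `F_s x = ∑ j, s j * (a * sin (k * x j))`, one for each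
sign vector `s : Fin d → ℤˣ`. Their gradients and Hessians act coordinatewise, so the smoothness
and Hessian-Lipschitz constants are those of `a * sin (k * t)`, independent of `d`. With
`a = (8 / √ρ) * ε ^ (3 / 2)` and `k = √ρ / (2 * √ε)` the third derivative has size exactly `ρ`, and at
an `ε`-SOSP of `F_s` every coordinate satisfies `|cos (k * x j)| ≤ 1 / 4` and
`s j * sin (k * x j) ≤ 1 / 2`, hence `s j * sin (k * x j) < 0`. A point therefore determines the only
sign vector for which it can be an `ε`-SOSP (`eq_of_isSOSP_sineSum`): succeeding means learning `d`
bits.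

The noisy oracle rounds `F_s` to a multiple of `1 / d ^ p`. As `F_s` is bounded by a multiple of `d`,
an answer takes at most `d ^ (p + 2)` values, so a deterministic algorithm with `n` queries has at
most `d ^ ((p + 2) * n)` possible outputs (`QueryAlgorithm.card_image_run_le`) and succeeds for at
most that many of the `2 ^ d` sign vectors. If `n ≤ c * d / log d` with `c` small this is
at most `2 ^ (d / 2)`, less than the fraction `θ` of all sign vectors. Averaging over the seed
transfers the bound to randomized algorithms (`le_sum_measureReal_of_ae_le_card`).
-/

open MeasureTheory

/-! ### Separable functions on Euclidean space -/

theorem hasGradientAt_sum_coord {d : ℕ} {g g' : Fin d → ℝ → ℝ}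
    (hg : ∀ j t, HasDerivAt (g j) (g' j t) t) (x : EuclideanSpace ℝ (Fin d)) :
    HasGradientAt (fun x : EuclideanSpace ℝ (Fin d) => ∑ j, g j (x j))
      (WithLp.toLp 2 fun j => g' j (x j)) x := by
  rw [hasGradientAt_iff_hasFDerivAt]
  have h : HasFDerivAt (fun x : EuclideanSpace ℝ (Fin d) => ∑ j, g j (x j))
      (∑ j, g' j (x j) • (EuclideanSpace.proj j : EuclideanSpace ℝ (Fin d) →L[ℝ] ℝ)) x :=
    HasFDerivAt.fun_sum fun j _ => (hg j (x j)).comp_hasFDerivAt x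
      (EuclideanSpace.proj j : EuclideanSpace ℝ (Fin d) →L[ℝ] ℝ).hasFDerivAt
  have h' : InnerProductSpace.toDual ℝ (EuclideanSpace ℝ (Fin d))
      (WithLp.toLp 2 fun j => g' j (x j)) =
      ∑ j, g' j (x j) • (EuclideanSpace.proj j : EuclideanSpace ℝ (Fin d) →L[ℝ] ℝ) := by
    ext v
    simp [PiLp.inner_apply, mul_comm]
  rwa [h']

theorem gradient_sum_coord {d : ℕ} {g g' : Fin d → ℝ → ℝ}
    (hg : ∀ j t, HasDerivAt (g j) (g' j t) t) :
    gradient (fun x : EuclideanSpace ℝ (Fin d) => ∑ j, g j (x j)) =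
      fun x => WithLp.toLp 2 fun j => g' j (x j) :=
  funext fun x => (hasGradientAt_sum_coord hg x).gradient

theorem differentiable_gradient_sum_coord {d : ℕ} {g g' g'' : Fin d → ℝ → ℝ}
    (hg : ∀ j t, HasDerivAt (g j) (g' j t) t) (hg' : ∀ j t, HasDerivAt (g' j) (g'' j t) t) :
    Differentiable ℝ (gradient (fun x : EuclideanSpace ℝ (Fin d) => ∑ j, g j (x j))) := by
  rw [gradient_sum_coord hg, differentiable_euclidean]
  exact fun j x => ((hg' j (x j)).comp_hasFDerivAt x
    (EuclideanSpace.proj j : EuclideanSpace ℝ (Fin d) →L[ℝ] ℝ).hasFDerivAt).differentiableAt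

/-- The Hessian of a separable function is diagonal. -/
theorem hessian_sum_coord_apply {d : ℕ} {g g' g'' : Fin d → ℝ → ℝ}
    (hg : ∀ j t, HasDerivAt (g j) (g' j t) t) (hg' : ∀ j t, HasDerivAt (g' j) (g'' j t) t)
    (x v : EuclideanSpace ℝ (Fin d)) (j : Fin d) :
    hessian (fun x : EuclideanSpace ℝ (Fin d) => ∑ j, g j (x j)) x v j = g'' j (x j) * v j := by
  have h := (differentiable_gradient_sum_coord hg hg' x).hasFDerivAt
  have h₁ := (EuclideanSpace.proj j : EuclideanSpace ℝ (Fin d) →L[ℝ] ℝ).hasFDerivAt.comp x h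
  have h₂ := (hg' j (x j)).comp_hasFDerivAt x
    (EuclideanSpace.proj j : EuclideanSpace ℝ (Fin d) →L[ℝ] ℝ).hasFDerivAt
  rw [gradient_sum_coord hg] at h₁
  have h₃ := congrArg (fun L => L v) (h₁.unique h₂)
  simpa [hessian, gradient_sum_coord hg] using h₃

theorem EuclideanSpace.norm_le_mul_norm_of_coord {d : ℕ} {M : ℝ} (hM : 0 ≤ M)
    {u v : EuclideanSpace ℝ (Fin d)} (h : ∀ j, |u j| ≤ M * |v j|) : ‖u‖ ≤ M * ‖v‖ := by
  have h₀ : ‖u‖ ≤ ‖M • v‖ := by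
    rw [EuclideanSpace.norm_eq, EuclideanSpace.norm_eq]
    refine Real.sqrt_le_sqrt (Finset.sum_le_sum fun j _ => pow_le_pow_left₀ (norm_nonneg _) ?_ 2)
    simpa [abs_mul, abs_of_nonneg hM] using h j
  rwa [norm_smul, Real.norm_of_nonneg hM] at h₀

theorem norm_gradient_sum_coord_sub_le {d : ℕ} {g g' : Fin d → ℝ → ℝ} {M : ℝ}
    (hg : ∀ j t, HasDerivAt (g j) (g' j t) t) (hM : 0 ≤ M)
    (hlip : ∀ j s t, |g' j s - g' j t| ≤ M * |s - t|) (x y : EuclideanSpace ℝ (Fin d)) :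
    ‖gradient (fun x : EuclideanSpace ℝ (Fin d) => ∑ j, g j (x j)) x -
      gradient (fun x : EuclideanSpace ℝ (Fin d) => ∑ j, g j (x j)) y‖ ≤ M * ‖x - y‖ := by
  rw [gradient_sum_coord hg]
  exact EuclideanSpace.norm_le_mul_norm_of_coord hM fun j => by simpa using hlip j (x j) (y j)

theorem norm_hessian_sum_coord_sub_le {d : ℕ} {g g' g'' : Fin d → ℝ → ℝ} {M : ℝ}
    (hg : ∀ j t, HasDerivAt (g j) (g' j t) t) (hg' : ∀ j t, HasDerivAt (g' j) (g'' j t) t)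
    (hM : 0 ≤ M) (hlip : ∀ j s t, |g'' j s - g'' j t| ≤ M * |s - t|)
    (x y : EuclideanSpace ℝ (Fin d)) :
    ‖hessian (fun x : EuclideanSpace ℝ (Fin d) => ∑ j, g j (x j)) x -
      hessian (fun x : EuclideanSpace ℝ (Fin d) => ∑ j, g j (x j)) y‖ ≤ M * ‖x - y‖ := by
  refine ContinuousLinearMap.opNorm_le_bound _ (by positivity) fun v => ?_
  refine EuclideanSpace.norm_le_mul_norm_of_coord (by positivity) fun j => ?_
  simp only [_root_.sub_apply, PiLp.sub_apply, hessian_sum_coord_apply hg hg']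
  rw [← sub_mul, abs_mul]
  gcongr
  refine (hlip j _ _).trans ?_
  gcongr
  simpa using PiLp.norm_apply_le (x - y) j

/-- The standard basis vectors are eigenvectors of the Hessian of a separable function. -/
theorem hasEigenvalue_hessian_sum_coord {d : ℕ} {g g' g'' : Fin d → ℝ → ℝ}
    (hg : ∀ j t, HasDerivAt (g j) (g' j t) t) (hg' : ∀ j t, HasDerivAt (g' j) (g'' j t) t)
    (x : EuclideanSpace ℝ (Fin d)) (j : Fin d) :
    Module.End.HasEigenvalue
      (hessian (fun x : EuclideanSpace ℝ (Fin d) => ∑ j, g j (x j)) x).toLinearMap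
      (g'' j (x j)) := by
  refine Module.End.hasEigenvalue_of_hasEigenvector (x := EuclideanSpace.single j (1 : ℝ))
    ⟨Module.End.mem_eigenspace_iff.2 ?_, fun h => ?_⟩
  · ext i
    rw [ContinuousLinearMap.coe_coe, hessian_sum_coord_apply hg hg']
    rcases eq_or_ne i j with rfl | hij
    · simp
    · simp [hij]
  · simpa using congrArg (fun v : EuclideanSpace ℝ (Fin d) => v j) h

/-! ### Sums of sine waves with hidden signs -/

/-- The sum of the waves `a * sin (k * x j)`, each flipped by the sign `s j`. -/
noncomputable def sineSum {d : ℕ} (a k : ℝ) (s : Fin d → ℤˣ) (x : EuclideanSpace ℝ (Fin d)) : ℝ :=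
  ∑ j, ((s j : ℤ) : ℝ) * a * Real.sin (k * x j)

theorem Int.abs_units_cast_real (u : ℤˣ) : |((u : ℤ) : ℝ)| = 1 := by
  rcases Int.units_eq_one_or u with rfl | rfl <;> simp

theorem hasDerivAt_mul_sin (c k t : ℝ) :
    HasDerivAt (fun t => c * Real.sin (k * t)) (c * k * Real.cos (k * t)) t := by
  refine (((hasDerivAt_id t).const_mul k).sin.const_mul c).congr_deriv ?_
  simp only [id, mul_one]
  ring

theorem hasDerivAt_mul_cos (c k t : ℝ) :
    HasDerivAt (fun t => c * k * Real.cos (k * t)) (-(c * k ^ 2 * Real.sin (k * t))) t := by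
  refine (((hasDerivAt_id t).const_mul k).cos.const_mul (c * k)).congr_deriv ?_
  simp only [id, mul_one]
  ring

theorem abs_sineSum_le {d : ℕ} {a : ℝ} (ha : 0 ≤ a) (k : ℝ) (s : Fin d → ℤˣ)
    (x : EuclideanSpace ℝ (Fin d)) : |sineSum a k s x| ≤ d * a := by
  refine (Finset.abs_sum_le_sum_abs _ _).trans ?_
  refine (Finset.sum_le_card_nsmul _ _ a fun j _ => ?_).trans (by simp)
  rw [abs_mul, abs_mul, Int.abs_units_cast_real, one_mul, abs_of_nonneg ha]
  exact mul_le_of_le_one_right ha (Real.abs_sin_le_one _)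

theorem noisyEvaluation_sineSum {d : ℕ} {a k B ℓ ρ ν : ℝ} (ha : 0 ≤ a) (hk : 0 ≤ k)
    (hB : d * a ≤ B) (hℓ : a * k ^ 2 ≤ ℓ) (hρ : a * k ^ 3 ≤ ρ) (s : Fin d → ℤˣ)
    {f : EuclideanSpace ℝ (Fin d) → ℝ} (hf : ∀ x, |sineSum a k s x - f x| ≤ ν) :
    NoisyEvaluation B ℓ ρ ν (sineSum a k s) f := by
  have hg := fun (j : Fin d) t => hasDerivAt_mul_sin (((s j : ℤ) : ℝ) * a) k t
  have hg' := fun (j : Fin d) t => hasDerivAt_mul_cos (((s j : ℤ) : ℝ) * a) k t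
  refine ⟨fun x => (hasGradientAt_sum_coord hg x).differentiableAt,
    differentiable_gradient_sum_coord hg hg', fun x => (abs_sineSum_le ha k s x).trans hB,
    fun x y => ?_, fun x y => ?_, hf⟩
  · refine (norm_gradient_sum_coord_sub_le hg (M := a * k ^ 2) (by positivity)
      (fun j t u => ?_) x y).trans (by gcongr)
    rw [← mul_sub, abs_mul, abs_mul, abs_mul, Int.abs_units_cast_real, abs_of_nonneg ha,
      abs_of_nonneg hk]
    have h := Real.abs_cos_sub_cos_le (k * t) (k * u)
    rw [← mul_sub, abs_mul, abs_of_nonneg hk] at h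
    calc 1 * a * k * |Real.cos (k * t) - Real.cos (k * u)| ≤ 1 * a * k * (k * |t - u|) := by gcongr
      _ = a * k ^ 2 * |t - u| := by ring
  · refine (norm_hessian_sum_coord_sub_le hg hg' (M := a * k ^ 3) (by positivity)
      (fun j t u => ?_) x y).trans (by gcongr)
    rw [neg_sub_neg, ← mul_sub, abs_mul, abs_mul, abs_mul, Int.abs_units_cast_real,
      abs_of_nonneg ha, abs_of_nonneg (pow_nonneg hk 2)]
    have h := Real.abs_sin_sub_sin_le (k * u) (k * t)
    rw [← mul_sub, abs_mul, abs_of_nonneg hk, abs_sub_comm u] at h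
    calc 1 * a * k ^ 2 * |Real.sin (k * u) - Real.sin (k * t)|
        ≤ 1 * a * k ^ 2 * (k * |t - u|) := by gcongr
      _ = a * k ^ 3 * |t - u| := by ring

/-- At an `ε`-SOSP of a sine sum whose waves have slope `4 * ε` and curvature `2 * √(ρ * ε)`, every
signed wave is negative: the gradient bound forces `|cos| ≤ 1 / 4`, and the maxima of the wave are
excluded by the Hessian bound. -/
theorem mul_sin_neg_of_isSOSP_sineSum {d : ℕ} {a k ρ ε : ℝ} (hρ : 0 < ρ) (hε : 0 < ε)
    (h₁ : a * k = 4 * ε) (h₂ : a * k ^ 2 = 2 * √(ρ * ε)) {s : Fin d → ℤˣ}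
    {x : EuclideanSpace ℝ (Fin d)} (h : IsSOSP ρ ε (sineSum a k s) x) (j : Fin d) :
    ((s j : ℤ) : ℝ) * Real.sin (k * x j) < 0 := by
  have hg := fun (j : Fin d) t => hasDerivAt_mul_sin (((s j : ℤ) : ℝ) * a) k t
  have hg' := fun (j : Fin d) t => hasDerivAt_mul_cos (((s j : ℤ) : ℝ) * a) k t
  have hgrad := (PiLp.norm_apply_le (gradient (sineSum a k s) x) j).trans h.1
  have hhess := h.2 _ (hasEigenvalue_hessian_sum_coord hg hg' x j)
  have hgr : gradient (sineSum a k s) x j = ((s j : ℤ) : ℝ) * a * k * Real.cos (k * x j) :=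
    congrArg (fun G => G x j) (gradient_sum_coord hg)
  have hu := Int.abs_units_cast_real (s j)
  rw [hgr, mul_assoc _ a k, h₁, Real.norm_eq_abs, abs_mul, abs_mul, hu,
    abs_of_pos (by positivity : 0 < 4 * ε)] at hgrad
  have hcos : |Real.cos (k * x j)| ≤ 1 / 4 := by
    refine le_of_mul_le_mul_left ?_ (by positivity : 0 < 4 * ε)
    linarith
  rw [mul_assoc _ a (k ^ 2), h₂] at hhess
  have hr : 0 < √(ρ * ε) := by positivity
  have hsin : ((s j : ℤ) : ℝ) * Real.sin (k * x j) ≤ 1 / 2 := by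
    refine le_of_mul_le_mul_left ?_ (by positivity : 0 < 2 * √(ρ * ε))
    linarith
  by_contra! hneg
  have hsq : (((s j : ℤ) : ℝ) * Real.sin (k * x j)) ^ 2 = Real.sin (k * x j) ^ 2 := by
    rw [mul_pow, ← sq_abs ((s j : ℤ) : ℝ), hu]; ring
  have hc2 : Real.cos (k * x j) ^ 2 ≤ (1 / 4) ^ 2 := by
    rw [← sq_abs]; gcongr
  have hs2 := pow_le_pow_left₀ hneg hsin 2
  have := Real.sin_sq_add_cos_sq (k * x j)
  linarith

/-- A point is an `ε`-SOSP for at most one choice of the hidden signs. -/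
theorem eq_of_isSOSP_sineSum {d : ℕ} {a k ρ ε : ℝ} (hρ : 0 < ρ) (hε : 0 < ε)
    (h₁ : a * k = 4 * ε) (h₂ : a * k ^ 2 = 2 * √(ρ * ε)) {s t : Fin d → ℤˣ}
    {x : EuclideanSpace ℝ (Fin d)} (hs : IsSOSP ρ ε (sineSum a k s) x)
    (ht : IsSOSP ρ ε (sineSum a k t) x) : s = t := by
  funext j
  have h₃ := mul_sin_neg_of_isSOSP_sineSum hρ hε h₁ h₂ hs j
  have h₄ := mul_sin_neg_of_isSOSP_sineSum hρ hε h₁ h₂ ht j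
  rcases Int.units_eq_one_or (s j) with h | h <;> rcases Int.units_eq_one_or (t j) with h' | h' <;>
    rw [h] at h₃ <;> rw [h'] at h₄ <;> rw [h, h'] <;> norm_num at h₃ h₄ <;> linarith

/-! ### Rounding to a grid -/

/-- The multiples `m * δ` with `|m| ≤ N`. -/
noncomputable def roundingGrid (δ : ℝ) (N : ℕ) : Finset ℝ :=
  (Finset.Icc (-(N : ℤ)) N).image fun m : ℤ => (m : ℝ) * δ

theorem card_roundingGrid_le (δ : ℝ) (N : ℕ) : (roundingGrid δ N).card ≤ 2 * N + 1 := by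
  refine Finset.card_image_le.trans ?_
  rw [Int.card_Icc]
  omega

theorem abs_sub_round_mul_le {δ : ℝ} (hδ : 0 < δ) (y : ℝ) :
    |y - (round (y / δ) : ℝ) * δ| ≤ δ := by
  have h : y - (round (y / δ) : ℝ) * δ = (y / δ - round (y / δ)) * δ := by field_simp
  rw [h, abs_mul, abs_of_pos hδ]
  have := abs_sub_round (y / δ)
  exact mul_le_of_le_one_left hδ.le (by linarith)

theorem round_mul_mem_roundingGrid {δ y : ℝ} {N : ℕ} (hδ : 0 < δ) (hy : |y| + δ ≤ N * δ) :
    (round (y / δ) : ℝ) * δ ∈ roundingGrid δ N := by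
  refine Finset.mem_image_of_mem _ (Finset.mem_Icc.2 (abs_le.1 ?_))
  have h₁ := abs_sub_abs_le_abs_sub ((round (y / δ) : ℝ) * δ) y
  rw [abs_sub_comm, abs_mul, abs_of_pos hδ] at h₁
  have h₂ := abs_sub_round_mul_le hδ y
  have h₃ : |(round (y / δ) : ℝ)| ≤ N := le_of_mul_le_mul_right (by linarith) hδ
  exact_mod_cast h₃

/-! ### Counting outputs and averaging over the seed -/

/-- A deterministic algorithm making at most `n` queries, each answered by a value in `V`, has at
most `#V ^ n` different outputs. -/
theorem QueryAlgorithm.card_image_run_le {d : ℕ} {ι : Type*}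
    (f : ι → EuclideanSpace ℝ (Fin d) → ℝ) {V : Finset ℝ} (hV : V.Nonempty)
    (hf : ∀ i x, f i x ∈ V) (A : QueryAlgorithm d) (S : Finset ι) (n : ℕ)
    (hn : ∀ i ∈ S, A.numQueries (f i) ≤ n) :
    (S.image fun i => A.run (f i)).card ≤ V.card ^ n := by
  classical
  induction A generalizing S n with
  | output x =>
    calc (S.image fun i => (QueryAlgorithm.output x).run (f i)).card ≤ ({x} : Finset _).card :=
          Finset.card_le_card (by
            intro y hy
            obtain ⟨i, -, rfl⟩ := Finset.mem_image.1 hy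
            simp [QueryAlgorithm.run])
      _ ≤ V.card ^ n := by
          rw [Finset.card_singleton]
          exact Nat.one_le_pow _ _ hV.card_pos
  | query x next ih =>
    rcases n with _ | n
    · have hS : S = ∅ := Finset.eq_empty_of_forall_notMem fun i hi => by
        simpa [QueryAlgorithm.numQueries] using hn i hi
      simp [hS]
    · have hsub : (S.image fun i => (QueryAlgorithm.query x next).run (f i)) ⊆
          V.biUnion fun v => (S.filter fun i => f i x = v).image fun i => (next v).run (f i) := by
        intro y hy
        obtain ⟨i, hi, rfl⟩ := Finset.mem_image.1 hy
        exact Finset.mem_biUnion.2 ⟨f i x, hf i x,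
          Finset.mem_image.2 ⟨i, Finset.mem_filter.2 ⟨hi, rfl⟩, rfl⟩⟩
      refine (Finset.card_le_card hsub).trans ((Finset.card_biUnion_le_card_mul _ _ (V.card ^ n)
        fun v _ => ih v _ n fun i hi => ?_).trans (by rw [pow_succ']))
      obtain ⟨hiS, rfl⟩ := Finset.mem_filter.1 hi
      simpa [QueryAlgorithm.numQueries] using hn i hiS

/-- If almost every point lies in at least `N` of the events, their probabilities add up to at
least `N`. The events need not be measurable. -/
theorem le_sum_measureReal_of_ae_le_card {Ω ι : Type*} [Fintype ι] [MeasurableSpace Ω]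
    (P : Measure Ω) [IsProbabilityMeasure P] (E : ι → Set Ω) (N : ℝ)
    (h : ∀ᵐ ω ∂P, N ≤ ({i | ω ∈ E i} : Set ι).ncard) : N ≤ ∑ i, P.real (E i) := by
  classical
  -- measurable hulls have the same outer measure and contain the events
  have hM : ∀ i, MeasurableSet (toMeasurable P (E i)) := fun i => measurableSet_toMeasurable _ _
  have hint : ∀ i, Integrable ((toMeasurable P (E i)).indicator (1 : Ω → ℝ)) P := fun i =>
    (integrable_const (1 : ℝ)).indicator (hM i)
  calc N = ∫ _, N ∂P := by simp
    _ ≤ ∫ ω, ∑ i, (toMeasurable P (E i)).indicator (1 : Ω → ℝ) ω ∂P := by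
        refine integral_mono_ae (integrable_const _) (integrable_finsetSum _ fun i _ => hint i) ?_
        filter_upwards [h] with ω hω
        refine hω.trans ?_
        rw [Set.ncard_eq_toFinset_card', Finset.card_eq_sum_ones, Nat.cast_sum, Nat.cast_one,
          Set.toFinset_ofPred, Finset.sum_filter]
        refine Finset.sum_le_sum fun i _ => ?_
        split_ifs with hi
        · simp [subset_toMeasurable P (E i) hi]
        · exact Set.indicator_nonneg (fun _ _ => zero_le_one) _
    _ = ∑ i, P.real (E i) := by
        rw [integral_finsetSum _ fun i _ => hint i]
        refine Finset.sum_congr rfl fun i _ => ?_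
        rw [integral_indicator_one (hM i), measureReal_def, measure_toMeasurable, measureReal_def]

/-- If each point is an `ε`-SOSP of at most one `F i`, and the answers to the queries lie in the
finite set `V`, an algorithm that almost surely makes at most `n` queries fails on all but
`#V ^ n` of the pairs, on average over its seed. -/
theorem card_sub_pow_le_sum_failureProb {d : ℕ} {ι Ω : Type*} [Fintype ι] [MeasurableSpace Ω]
    (P : Measure Ω) [IsProbabilityMeasure P] (A : Ω → QueryAlgorithm d) {ρ ε : ℝ}
    {F f : ι → EuclideanSpace ℝ (Fin d) → ℝ}
    (huniq : ∀ i j x, IsSOSP ρ ε (F i) x → IsSOSP ρ ε (F j) x → i = j)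
    {V : Finset ℝ} (hV : V.Nonempty) (hf : ∀ i x, f i x ∈ V) {n : ℕ}
    (hn : ∀ᵐ ω ∂P, ∀ i, (A ω).numQueries (f i) ≤ n) :
    (Fintype.card ι : ℝ) - (V.card : ℝ) ^ n ≤ ∑ i, failureProb P A ρ ε (F i) (f i) := by
  classical
  refine le_sum_measureReal_of_ae_le_card P _ _ ?_
  filter_upwards [hn] with ω hω
  set S : Finset ι := Finset.univ.filter fun i => IsSOSP ρ ε (F i) ((A ω).run (f i)) with hS
  have hinj : Set.InjOn (fun i => (A ω).run (f i)) S := by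
    intro i hi j hj hij
    have hi' := (Finset.mem_filter.1 hi).2
    have hj' := (Finset.mem_filter.1 hj).2
    refine huniq i j _ hi' ?_
    simpa only [show (A ω).run (f i) = (A ω).run (f j) from hij] using hj'
  have hcard : S.card ≤ V.card ^ n := by
    rw [← Finset.card_image_of_injOn hinj]
    exact (A ω).card_image_run_le f hV hf S n fun i _ => hω i
  have hcompl : ({i | ¬ IsSOSP ρ ε (F i) ((A ω).run (f i))} : Set ι).ncard
      = Fintype.card ι - S.card := by
    rw [← Finset.card_compl, ← Set.ncard_coe_finset]
    congr 1
    ext i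
    simp [hS]
  rw [hcompl, Nat.cast_sub (Finset.card_le_univ S)]
  have : (S.card : ℝ) ≤ (V.card : ℝ) ^ n := by exact_mod_cast hcard
  linarith

/-! ### The choice of parameters -/

theorem rpow_three_halves_eq {ε : ℝ} (hε : 0 < ε) : ε ^ (3 / 2 : ℝ) = √ε ^ 3 := by
  rw [Real.sqrt_eq_rpow, ← Real.rpow_natCast, ← Real.rpow_mul hε.le]
  norm_num

/-- With at most `log 2 / (2 * q) * d / log d` queries, answers from `d ^ q` values carry at most
`d / 2` bits, too few to reach a fraction `θ` of the `2 ^ d` sign vectors. -/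
theorem pow_lt_mul_two_pow {q d n K : ℕ} {θ : ℝ} (hq : 0 < q) (hθ : 0 < θ) (hd : 2 ≤ d)
    (hdθ : 2 / (θ * Real.log 2) ≤ d) (hK : K ≤ d ^ q)
    (hn : (n : ℝ) ≤ Real.log 2 / (2 * q) * d / Real.log d) :
    (K : ℝ) ^ n < θ * 2 ^ d := by
  have hd' : (2 : ℝ) ≤ d := by exact_mod_cast hd
  have hlog : 0 < Real.log d := Real.log_pos (by linarith)
  have hlog2 : 0 < Real.log 2 := Real.log_pos (by norm_num)
  have hq' : (0 : ℝ) < q := by exact_mod_cast hq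
  have hexp : ∀ m : ℕ, ∀ y : ℝ, 0 < y → y ^ m = Real.exp (m * Real.log y) := fun m y hy => by
    rw [Real.exp_nat_mul, Real.exp_log hy]
  have h₁ : (n : ℝ) * (q * Real.log d) ≤ d * Real.log 2 / 2 := by
    rw [le_div_iff₀ hlog] at hn
    calc (n : ℝ) * (q * Real.log d) = q * (n * Real.log d) := by ring
      _ ≤ q * (Real.log 2 / (2 * q) * d) := by gcongr
      _ = d * Real.log 2 / 2 := by field_simp
  have h₂ : 1 < θ * Real.exp (d * Real.log 2 / 2) := by
    rw [div_le_iff₀ (by positivity)] at hdθ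
    have := Real.add_one_le_exp (d * Real.log 2 / 2)
    nlinarith
  calc (K : ℝ) ^ n ≤ ((d : ℝ) ^ q) ^ n := by gcongr; exact_mod_cast hK
    _ = Real.exp (n * (q * Real.log d)) := by
        rw [hexp q d (by linarith), ← Real.exp_nat_mul]
    _ ≤ Real.exp (d * Real.log 2 / 2) * 1 := by rw [mul_one]; gcongr
    _ < Real.exp (d * Real.log 2 / 2) * (θ * Real.exp (d * Real.log 2 / 2)) := by gcongr
    _ = θ * 2 ^ d := by
        rw [hexp d 2 (by norm_num), mul_left_comm, ← Real.exp_add]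
        ring_nf

theorem theorem1p7 (ℓ ρ : ℝ) (hℓ : 0 < ℓ) (hρ : 0 < ρ) :
    ∃ ε₀ b : ℝ, 0 < ε₀ ∧ ε₀ < 1 ∧ 0 < b ∧
      -- every inverse polynomial noise level and every target success probability
      ∀ (p : ℕ) (θ : ℝ), 0 < θ →
        ∃ c : ℝ, 0 < c ∧ ∃ d₀ : ℕ, ∀ d : ℕ, d₀ ≤ d →
          ∀ ε : ℝ, 0 < ε → ε ≤ ε₀ →
            ∀ B ν : ℝ, b * d * ε ^ (3 / 2 : ℝ) ≤ B → 1 / (d : ℝ) ^ p ≤ ν →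
              -- a random pair `(F i, f i)`, with `i` uniform in a finite set, chosen before
              -- the algorithm
              ∃ (ι : Type) (_ : Fintype ι) (_ : Nonempty ι)
                (F f : ι → EuclideanSpace ℝ (Fin d) → ℝ),
                (∀ i, NoisyEvaluation B ℓ ρ ν (F i) (f i)) ∧
                ∀ (Ω : Type*) (_ : MeasurableSpace Ω) (P : MeasureTheory.Measure Ω)
                  (_ : MeasureTheory.IsProbabilityMeasure P) (A : Ω → QueryAlgorithm d),
                  -- if `A` succeeds with probability at least `θ` over `i` and its own seed
                  (∑ i, failureProb P A ρ ε (F i) (f i)) / Fintype.card ι ≤ 1 - θ →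
                  -- then on some pair it makes at least `c d / log d` queries with positive
                  -- probability
                  ∃ i, 0 < P {ω | c * d / Real.log d ≤ ((A ω).numQueries (f i) : ℝ)} := by
  have hr : 0 < √ρ := Real.sqrt_pos.2 hρ
  have hlog2 : 0 < Real.log 2 := Real.log_pos (by norm_num)
  -- the bound on `ε` keeps the curvature `2 * √(ρ * ε)` below `ℓ`
  refine ⟨min (1 / 2) (ℓ ^ 2 / (4 * ρ)), 8 / √ρ, by positivity,
    (min_le_left _ _).trans_lt (by norm_num), by positivity, fun p θ hθ => ?_⟩
  refine ⟨Real.log 2 / (2 * (p + 2 : ℕ)), by positivity,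
    max 2 (max ⌈2 * (8 / √ρ) + 5⌉₊ ⌈2 / (θ * Real.log 2)⌉₊), fun d hd ε hε hε₀ B ν hB hν => ?_⟩
  simp only [max_le_iff, Nat.ceil_le] at hd
  obtain ⟨hd2, hdb, hdθ⟩ := hd
  have hdpos : (0 : ℝ) < d := by exact_mod_cast (by omega : 0 < d)
  have hd1 : (1 : ℝ) ≤ d := by exact_mod_cast (by omega : 1 ≤ d)
  set b : ℝ := 8 / √ρ with hb
  have hbpos : 0 < b := by positivity
  have he : 0 < √ε := Real.sqrt_pos.2 hε
  have he2 : √ε ^ 2 = ε := Real.sq_sqrt hε.le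
  have hr2 : √ρ ^ 2 = ρ := Real.sq_sqrt hρ.le
  set a : ℝ := b * ε ^ (3 / 2 : ℝ) with ha
  have ha3 : a = b * √ε ^ 3 := by rw [ha, rpow_three_halves_eq hε]
  set k : ℝ := √ρ / (2 * √ε) with hk
  have hapos : 0 < a := by positivity
  have hkpos : 0 < k := by positivity
  have hak : a * k = 4 * ε := by
    rw [ha3, hb, hk]; field_simp; rw [he2]; ring
  have hak2 : a * k ^ 2 = 2 * √(ρ * ε) := by
    rw [ha3, hb, hk, Real.sqrt_mul hρ.le]; field_simp; norm_num
  have hak3 : a * k ^ 3 = ρ := by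
    rw [ha3, hb, hk]; field_simp; rw [hr2]; ring
  have hcurv : a * k ^ 2 ≤ ℓ := by
    have h : ρ * ε ≤ (ℓ / 2) ^ 2 := by
      have := hε₀.trans (min_le_right _ _)
      rw [le_div_iff₀ (by positivity)] at this
      nlinarith
    have := Real.sqrt_le_sqrt h
    rw [Real.sqrt_sq (by positivity)] at this
    rw [hak2]; linarith
  have hab : a ≤ b := by
    refine mul_le_of_le_one_right hbpos.le (Real.rpow_le_one hε.le ?_ (by norm_num))
    exact (hε₀.trans (min_le_left _ _)).trans (by norm_num)
  set δ : ℝ := 1 / (d : ℝ) ^ p with hδ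
  have hδpos : 0 < δ := by positivity
  -- `F / δ` is bounded by `b * d ^ (p + 1)`, and rounding adds at most one
  set N : ℕ := ⌈b * (d : ℝ) ^ (p + 1)⌉₊ + 1 with hN
  have hNδ : d * a + δ ≤ N * δ := by
    have h₁ : d * a ≤ b * (d : ℝ) ^ (p + 1) * δ := by
      calc d * a ≤ d * b := by gcongr
        _ = b * (d : ℝ) ^ (p + 1) * δ := by rw [hδ]; field_simp; ring
    have h₂ : b * (d : ℝ) ^ (p + 1) * δ ≤ ⌈b * (d : ℝ) ^ (p + 1)⌉₊ * δ := by
      gcongr; exact Nat.le_ceil _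
    rw [hN]; push_cast; linarith
  have hcard : (roundingGrid δ N).card ≤ d ^ (p + 2) := by
    refine (card_roundingGrid_le δ N).trans ?_
    have h₁ := (Nat.ceil_lt_add_one (by positivity : 0 ≤ b * (d : ℝ) ^ (p + 1))).le
    have h₂ : (1 : ℝ) ≤ (d : ℝ) ^ (p + 1) := one_le_pow₀ hd1
    have h₃ : ((2 * N + 1 : ℕ) : ℝ) ≤ (d : ℝ) ^ (p + 2) := by
      rw [hN]; push_cast
      calc 2 * ((⌈b * (d : ℝ) ^ (p + 1)⌉₊ : ℝ) + 1) + 1 ≤ (2 * b + 5) * (d : ℝ) ^ (p + 1) := by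
            linarith
        _ ≤ d * (d : ℝ) ^ (p + 1) := by gcongr
        _ = (d : ℝ) ^ (p + 2) := by ring
    exact_mod_cast h₃
  have hmem : ∀ (s : Fin d → ℤˣ) x,
      (round (sineSum a k s x / δ) : ℝ) * δ ∈ roundingGrid δ N := fun s x =>
    round_mul_mem_roundingGrid hδpos (by linarith [abs_sineSum_le hapos.le k s x])
  refine ⟨Fin d → ℤˣ, inferInstance, inferInstance, sineSum a k,
    fun s x => (round (sineSum a k s x / δ) : ℝ) * δ, fun s => ?_, ?_⟩
  · refine noisyEvaluation_sineSum hapos.le hkpos.le ?_ hcurv hak3.le s fun x =>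
      (abs_sub_round_mul_le hδpos _).trans hν
    exact le_of_eq_of_le (by rw [ha]; ring) hB
  · intro Ω _ P _ A hA
    by_contra! hno
    have hn : ∀ᵐ ω ∂P, ∀ s : Fin d → ℤˣ,
        (A ω).numQueries (fun x => (round (sineSum a k s x / δ) : ℝ) * δ) ≤
          ⌊Real.log 2 / (2 * (p + 2 : ℕ)) * d / Real.log d⌋₊ := by
      refine ae_all_iff.2 fun s => ?_
      have h := measure_eq_zero_iff_ae_notMem.1 (nonpos_iff_eq_zero.1 (hno s))
      filter_upwards [h] with ω hω
      exact Nat.le_floor (not_le.1 hω).le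
    have hfail := card_sub_pow_le_sum_failureProb P A
      (fun s t x => eq_of_isSOSP_sineSum hρ hε hak hak2) ⟨_, hmem 1 0⟩ hmem hn
    have hsmall := pow_lt_mul_two_pow (by omega : 0 < p + 2) hθ hd2 hdθ hcard
      (Nat.floor_le (by positivity))
    have hι : (Fintype.card (Fin d → ℤˣ) : ℝ) = 2 ^ d := by simp
    rw [div_le_iff₀ (by rw [hι]; positivity)] at hA
    rw [hι] at hA hfail
    linarith
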